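/- Let $\mathcal{X}$ be a measurable space with a probability measure $\mu$, let $a \le 0 < b$ and $z = \max\{|a|,|b|\}$, and let $\mathcal{F}$ be a class of measurable functions $f:\mathcal{X}\to[a,b]$ that contains the zero function. For $m\ge 1$, a sample $\mathcal{S}=(s_1,\dots,s_m)\in\mathcal{X}^m$ and signs $\boldsymbol\sigma=(\sigma_1,\dots,\sigma_m)\in\{-1,1\}^m$, define the $1$-draw Monte Carlo empirical Rademacher average $$\hat{\mathsf R}^1_m(\mathcal{F},\mathcal{S},\boldsymbol\sigma)=\sup_{f\in\mathcal{F}}\frac1m\sum_{i=1}^m\sigma_i f(s_i),$$ which is assumed to be a measurable function of $\mathcal{S}$ for every sample size and every choice of the signs. Let $\mathsf R(\mathcal{F},m)=\mathbb{E}_{\mathcal{S}}\,\mathbb{E}_{\boldsymbol\sigma}\big[\hat{\mathsf R}^1_m(\mathcal{F},\mathcal{S},\boldsymbol\sigma)\big]$ be the Rademacher complexity, where $s_1,\dots,s_m$ are i.i.d. with law $\mu$ and, independently of them, $\sigma_1,\dots,\sigma_m$ are independent and uniform on $\{-1,1\}$, and let $\sigma^2_{\mathcal{F}}=\sup_{f\in\mathcal{F}}\mathbb{E}_{x\sim\mu}[f(x)^2]$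 be the wimpy variance. Then for every $\delta\in(0,1)$, with probability at least $1-\delta$ over $(\mathcal{S},\boldsymbol\sigma)$, the following two inequalities both hold: $$\mathsf R(\mathcal{F},m)\le \hat{\mathsf R}^1_m(\mathcal{F},\mathcal{S},\boldsymbol\sigma)+\sqrt{\frac{2\big(2z\,\mathsf R(\mathcal{F},m)+\sigma^2_{\mathcal{F}}\big)\ln(1/\delta)}{m}}+\frac{z\ln(1/\delta)}{8m}$$ $$\le \hat{\mathsf R}^1_m(\mathcal{F},\mathcal{S},\boldsymbol\sigma)+\sqrt{\frac98\Big(\frac{2z\ln(1/\delta)}{m}\Big)^2+\frac{2\big(2z\,\hat{\mathsf R}^1_m(\mathcal{F},\mathcal{S},\boldsymbol\sigma)+\sigma^2_{\mathcal{F}}\big)\ln(1/\delta)}{m}}+\frac{17z\ln(1/\delta)}{8m}.$$ -/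

import Mathlib

open MeasureTheory

noncomputable section

instance : MeasurableSingletonClass ℤˣ where
  measurableSet_singleton u :=
    ⟨{(u : ℤ)}, MeasurableSet.of_discrete, by ext v; simp [Units.ext_iff]⟩

/-- The law of a Rademacher variable: `1` and `-1` with probability `1/2` each
(the type `ℤˣ` has exactly the two elements `1` and `-1`). -/
def rademacher : Measure ℤˣ :=
  (2 : ENNReal)⁻¹ • (Measure.dirac 1 + Measure.dirac (-1))

instance : IsProbabilityMeasure rademacher := by
  constructor
  simp [rademacher, ENNReal.inv_two_add_inv_two]

/-- The law of an `n × m` matrix of independent Rademacher variables. -/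
def signLaw (n m : ℕ) : Measure (Fin n → Fin m → ℤˣ) :=
  Measure.pi fun _ => Measure.pi fun _ => rademacher

/-- The law of a sample of `m` points drawn i.i.d. from `μ`. -/
def sampleLaw {X : Type*} [MeasurableSpace X] (μ : Measure X) (m : ℕ) : Measure (Fin m → X) :=
  Measure.pi fun _ => μ

/-- The `n`-Monte Carlo Empirical Rademacher Average of the class `F` on the sample `S`. -/
def mcera {X : Type*} {n m : ℕ} (F : Set (X → ℝ)) (S : Fin m → X)
    (σ : Fin n → Fin m → ℤˣ) : ℝ :=
  (1 / (n : ℝ)) * ∑ j, ⨆ f : F, (1 / (m : ℝ)) * ∑ i, ((σ j i : ℤ) : ℝ) * (f : X → ℝ) (S i)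

/-- The Empirical Rademacher Average, the expectation of the `n`-MCERA over the signs.
By `era_eq` below it is the same number for every `n ≥ 1`, so it is defined with `n = 1`. -/
def era {X : Type*} {m : ℕ} (F : Set (X → ℝ)) (S : Fin m → X) : ℝ :=
  ∫ σ, mcera F S σ ∂(signLaw 1 m)

/-- The Rademacher Complexity. -/
def rademacherComplexity {X : Type*} [MeasurableSpace X] (μ : Measure X) (F : Set (X → ℝ))
    (m : ℕ) : ℝ :=
  ∫ S, era F S ∂(sampleLaw μ m)

/-- The wimpy variance `sup_{f ∈ F} E[f²]`. -/
def wimpyVariance {X : Type*} [MeasurableSpace X] (μ : Measure X) (F : Set (X → ℝ)) : ℝ :=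
  ⨆ f : F, ∫ x, (f : X → ℝ) x ^ 2 ∂μ

theorem era_eq {X : Type*} {n m : ℕ} (hn : 0 < n) (F : Set (X → ℝ)) (S : Fin m → X) :
    ∫ σ, mcera F S σ ∂(signLaw n m) = era F S := by
  have key : ∀ k : ℕ, 0 < k → ∫ σ, mcera F S σ ∂(signLaw k m) =
      ∫ τ : Fin m → ℤˣ, (⨆ f : F, (1 / (m : ℝ)) * ∑ i, ((τ i : ℤ) : ℝ) * (f : X → ℝ) (S i))
        ∂(Measure.pi fun _ => rademacher) := by
    intro k hk
    have hk' : (k : ℝ) ≠ 0 := by positivity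
    simp only [mcera, signLaw]
    rw [integral_const_mul, integral_finsetSum]
    · have h : ∀ j : Fin k, ∫ σ : Fin k → Fin m → ℤˣ,
          (⨆ f : F, (1 / (m : ℝ)) * ∑ i, ((σ j i : ℤ) : ℝ) * (f : X → ℝ) (S i))
            ∂(Measure.pi fun _ => Measure.pi fun _ => rademacher) =
          ∫ τ : Fin m → ℤˣ, (⨆ f : F, (1 / (m : ℝ)) * ∑ i, ((τ i : ℤ) : ℝ) * (f : X → ℝ) (S i))
            ∂(Measure.pi fun _ => rademacher) := by
        intro j
        exact integral_comp_eval (μ := fun _ : Fin k => Measure.pi fun _ : Fin m => rademacher)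
          (f := fun τ : Fin m → ℤˣ =>
            ⨆ f : F, (1 / (m : ℝ)) * ∑ i, ((τ i : ℤ) : ℝ) * (f : X → ℝ) (S i))
          (Measurable.of_discrete.aestronglyMeasurable)
      simp only [h, Finset.sum_const, Finset.card_univ, Fintype.card_fin, nsmul_eq_mul]
      field_simp
    · intro j _
      exact Integrable.of_finite
  rw [key n hn, era, key 1 one_pos]

end

/-! The proof is the entropy method for the lower tail of a supremum. After division by `z`, put `Z
= sup_j ∑ ε_i g_j(x_i)` over `n` i.i.d. pairs (point, sign), with `|g_j| ≤ 1`, `E = E[Z]` and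
normalized wimpy variance `s`.

Tensorization (`ent_pi_le`) bounds the entropy of `exp(-lZ)` by one-coordinate entropies. With the
other coordinates fixed, compare `Z` with the supremum `ζ` that omits coordinate `i`. A
near-maximizer `f` of `ζ` gives `Z - ζ ≥ ε_i f(x_i)` up to a small error, and averaging over the
symmetric sign leaves only a loss of order `l² E[f²]` (`one_sub_lossConst_mul_le`). The resulting
bound `ent_exp_le` is linear in `Z - ζ`, so self-bounding (`sum_radSup_sub_le`) makes the sum over
coordinates at most a multiple of `Z`.

This is a differential inequality for `G(l) = log E[exp(-lZ)]`. Integrating it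
(`le_of_differential_inequality`) and applying Chernoff's bound gives `Z ≥ E - √(2(2E + ns)t)`
outside an event of probability `e^{-t}` (`measureReal_radSup_le`). Since `Z ≥ 0`, only parameters
with `l(2E + ns) ≤ E` matter, and for these the higher-order terms are absorbed. With `t = log(1/δ)`
this is the first inequality; the second then follows deterministically by completing a square
(`sqrt_add_le_sqrt_add`). -/

/-- The entropy `E[Y log Y] - E[Y] log E[Y]` of a positive function `Y`. -/
noncomputable def ent {Ω : Type*} [MeasurableSpace Ω] (P : Measure Ω) (Y : Ω → ℝ) : ℝ :=
  ∫ ω, Y ω * Real.log (Y ω) ∂P - (∫ ω, Y ω ∂P) * Real.log (∫ ω, Y ω ∂P)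

/-! ### Entropy: variational bounds and tensorization. -/

section Entropy

variable {Ω : Type*} [MeasurableSpace Ω] {P : Measure Ω} [IsProbabilityMeasure P]

theorem integrable_of_mem_Icc {Y : Ω → ℝ} {c C : ℝ} (hY : Measurable Y)
    (hb : ∀ ω, Y ω ∈ Set.Icc c C) : Integrable Y P :=
  Integrable.of_mem_Icc c C hY.aemeasurable (ae_of_all _ hb)

theorem integral_mem_Icc {Y : Ω → ℝ} {c C : ℝ} (hY : Measurable Y)
    (hb : ∀ ω, Y ω ∈ Set.Icc c C) : ∫ ω, Y ω ∂P ∈ Set.Icc c C := by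
  have hi : Integrable Y P := integrable_of_mem_Icc hY hb
  constructor
  · simpa using integral_mono (μ := P) (integrable_const c) hi fun ω => (hb ω).1
  · simpa using integral_mono (μ := P) hi (integrable_const C) fun ω => (hb ω).2

theorem log_mem_Icc {y c C : ℝ} (hc : 0 < c) (hy : y ∈ Set.Icc c C) :
    Real.log y ∈ Set.Icc (Real.log c) (Real.log C) :=
  ⟨Real.log_le_log hc hy.1, Real.log_le_log (hc.trans_le hy.1) hy.2⟩

theorem integrable_mul_log {Y T : Ω → ℝ} {c C : ℝ} (hc : 0 < c) (hY : Measurable Y)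
    (hT : Measurable T) (hbY : ∀ ω, Y ω ∈ Set.Icc c C) (hbT : ∀ ω, T ω ∈ Set.Icc c C) :
    Integrable (fun ω => Y ω * Real.log (T ω)) P := by
  refine (integrable_of_mem_Icc hY hbY).mul_bdd
    (c := max |Real.log c| |Real.log C|) hT.log.aestronglyMeasurable (ae_of_all _ fun ω => ?_)
  rw [Real.norm_eq_abs]
  exact abs_le_max_abs_abs (log_mem_Icc hc (hbT ω)).1 (log_mem_Icc hc (hbT ω)).2

/-- The right side is minimal at `u = ∫ Y`, where it equals the entropy. A free `u` lets the
one-coordinate estimate choose a convenient reference value. -/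
theorem ent_le_integral {Y : Ω → ℝ} {c C u : ℝ} (hc : 0 < c) (hY : Measurable Y)
    (hb : ∀ ω, Y ω ∈ Set.Icc c C) (hu : 0 < u) :
    ent P Y ≤ ∫ ω, Y ω * Real.log (Y ω) ∂P - (∫ ω, Y ω ∂P) * Real.log u
      - ∫ ω, Y ω ∂P + u := by
  have hM : 0 < ∫ ω, Y ω ∂P := hc.trans_le (integral_mem_Icc hY hb).1
  unfold ent
  set M := ∫ ω, Y ω ∂P
  have h := Real.log_le_sub_one_of_pos (div_pos hu hM)
  rw [Real.log_div hu.ne' hM.ne'] at h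
  have h2 := mul_le_mul_of_nonneg_left h hM.le
  have h3 : M * (u / M - 1) = u - M := by field_simp
  linarith

/-- One half of the variational formula for the entropy. -/
theorem integral_mul_log_le {Y T : Ω → ℝ} {c C : ℝ} (hc : 0 < c) (hY : Measurable Y)
    (hT : Measurable T) (hbY : ∀ ω, Y ω ∈ Set.Icc c C) (hbT : ∀ ω, T ω ∈ Set.Icc c C) :
    ∫ ω, Y ω * Real.log (T ω) ∂P ≤
      ent P Y + (∫ ω, Y ω ∂P) * Real.log (∫ ω, T ω ∂P) := by
  have hM : 0 < ∫ ω, Y ω ∂P := hc.trans_le (integral_mem_Icc hY hbY).1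
  have hτ : 0 < ∫ ω, T ω ∂P := hc.trans_le (integral_mem_Icc hT hbT).1
  have hiY : Integrable Y P := integrable_of_mem_Icc hY hbY
  have hiT : Integrable T P := integrable_of_mem_Icc hT hbT
  have hiYY := integrable_mul_log (P := P) hc hY hY hbY hbY
  have hiYT := integrable_mul_log (P := P) hc hY hT hbY hbT
  unfold ent
  set M := ∫ ω, Y ω ∂P with hMdef
  set τ := ∫ ω, T ω ∂P with hτdef
  have hpt : ∀ ω, Y ω * Real.log (T ω) ≤
      Y ω * Real.log (Y ω) + Y ω * (Real.log τ - Real.log M - 1) + T ω * (M / τ) := by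
    intro ω
    have hy : 0 < Y ω := hc.trans_le (hbY ω).1
    have ht : 0 < T ω := hc.trans_le (hbT ω).1
    have h := Real.log_le_sub_one_of_pos (div_pos (mul_pos ht hM) (mul_pos hy hτ))
    rw [Real.log_div (by positivity) (by positivity), Real.log_mul ht.ne' hM.ne',
      Real.log_mul hy.ne' hτ.ne'] at h
    have h2 := mul_le_mul_of_nonneg_left h hy.le
    have h3 : Y ω * (T ω * M / (Y ω * τ) - 1) = T ω * (M / τ) - Y ω := by field_simp
    linarith
  have h := integral_mono hiYT ((hiYY.add (hiY.mul_const _)).add (hiT.mul_const _)) hpt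
  rw [integral_add' (hiYY.add (hiY.mul_const _)) (hiT.mul_const _),
    integral_add' hiYY (hiY.mul_const _), integral_mul_const, integral_mul_const,
    ← hMdef, ← hτdef] at h
  have : τ * (M / τ) = M := by field_simp
  linarith

/-- Chain rule plus convexity of entropy: averaging out the second variable leaves a function `T` of
the first, whose entropy is at most the average of the entropies of the sections. The majorants `D`
and `R` are integrated in place of the conditional entropies, so no measurability of the latter is
needed. -/
theorem ent_prod_le {Ω' : Type*} [MeasurableSpace Ω'] {Q : Measure Ω'} [IsProbabilityMeasure Q]
    {Y D : Ω × Ω' → ℝ} {R : Ω → ℝ} {c C : ℝ} (hc : 0 < c) (hY : Measurable Y)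
    (hb : ∀ p, Y p ∈ Set.Icc c C) (hD : Integrable D (P.prod Q)) (hR : Integrable R P)
    (h₁ : ∀ b, ent P (fun a => Y (a, b)) ≤ ∫ a, D (a, b) ∂P)
    (h₂ : ∀ a, ent Q (fun b => Y (a, b)) ≤ R a) :
    ent (P.prod Q) Y ≤ ∫ p, D p ∂(P.prod Q) + ∫ a, R a ∂P := by
  have hYa : ∀ a, Measurable fun b => Y (a, b) := fun a => hY.comp measurable_prodMk_left
  have hYb : ∀ b, Measurable fun a => Y (a, b) := fun b => hY.comp measurable_prodMk_right
  set T : Ω → ℝ := fun a => ∫ b, Y (a, b) ∂Q with hTdef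
  have hT : Measurable T := (hY.stronglyMeasurable.integral_prod_right' (ν := Q)).measurable
  have hbT : ∀ a, T a ∈ Set.Icc c C := fun a => integral_mem_Icc (hYa a) fun b => hb _
  have hiY : Integrable Y (P.prod Q) := integrable_of_mem_Icc hY hb
  have hiYY := integrable_mul_log (P := P.prod Q) hc hY hY hb hb
  have hiYT : Integrable (fun p => Y p * Real.log (T p.1)) (P.prod Q) :=
    integrable_mul_log hc hY (hT.comp measurable_fst) hb
    fun p => hbT p.1
  have hiTT := integrable_mul_log (P := P) hc hT hT hbT hbT
  have hM : ∫ p, Y p ∂(P.prod Q) = ∫ a, T a ∂P := integral_prod _ hiY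
  have e₁ : ∫ p, Y p * Real.log (Y p) ∂(P.prod Q) ≤
      ∫ a, R a ∂P + ∫ a, T a * Real.log (T a) ∂P := by
    rw [integral_prod _ hiYY, ← integral_add hR hiTT]
    refine integral_mono hiYY.integral_prod_left (hR.add hiTT) fun a => ?_
    have := h₂ a
    simp only [ent] at this
    change _ ≤ R a + T a * Real.log (T a)
    linarith
  -- Convexity: write `∫ T log T` as a double integral of `Y log T`, then apply the variational
  -- formula to each section with the same test function `T`.
  have e₂ : ∫ a, T a * Real.log (T a) ∂P ≤ ∫ p, D p ∂(P.prod Q)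
      + (∫ p, Y p ∂(P.prod Q)) * Real.log (∫ p, Y p ∂(P.prod Q)) := by
    have : ∫ a, T a * Real.log (T a) ∂P = ∫ p, Y p * Real.log (T p.1) ∂(P.prod Q) := by
      rw [integral_prod (fun p : Ω × Ω' => Y p * Real.log (T p.1)) hiYT]
      simp only [integral_mul_const, hTdef]
    have hM' := integral_prod_symm _ hiY
    rw [this, integral_prod_symm _ hiYT, integral_prod_symm _ hD, hM]
    rw [hM] at hM'
    nth_rewrite 1 [hM']
    rw [← integral_mul_const, ← integral_add hD.integral_prod_right (hiY.integral_prod_right.mul_const _)]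
    refine integral_mono hiYT.integral_prod_right
      (hD.integral_prod_right.add (hiY.integral_prod_right.mul_const _)) fun b => ?_
    have := integral_mul_log_le (P := P) hc (hYb b) hT (fun a => hb _) hbT
    exact this.trans (add_le_add_left (h₁ b) _)
  unfold ent
  linarith

/-- Subadditivity (tensorization) of the entropy on a power of a probability space. -/
theorem ent_pi_le : ∀ (m : ℕ) {Y : (Fin m → Ω) → ℝ} {D : Fin m → (Fin m → Ω) → ℝ}
    {c C B : ℝ}, 0 < c → Measurable Y → (∀ ω, Y ω ∈ Set.Icc c C) →
    (∀ i, Measurable (D i)) → (∀ i ω, |D i ω| ≤ B) →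
    (∀ i ω, ent P (fun x => Y (Function.update ω i x)) ≤
      ∫ x, D i (Function.update ω i x) ∂P) →
    ent (Measure.pi fun _ : Fin m => P) Y ≤ ∑ i, ∫ ω, D i ω ∂(Measure.pi fun _ : Fin m => P) := by
  intro m
  induction m with
  | zero =>
    intro Y D c C B hc hY hb hD hDB h
    have hY0 : Y = fun _ => Y default := by ext ω; rw [Subsingleton.elim ω default]
    rw [hY0]
    simp [ent]
  | succ m ih =>
    intro Y D c C B hc hY hb hD hDB h
    have hmp := (measurePreserving_piFinSuccAbove (fun _ : Fin (m + 1) => P) 0).symm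
    set e := (MeasurableEquiv.piFinSuccAbove (fun _ : Fin (m + 1) => Ω) 0).symm with he
    have hee : ∀ a b, e (a, b) = (Fin.cons a b : Fin (m + 1) → Ω) := by
      intro a b
      simp [he, MeasurableEquiv.piFinSuccAbove, Fin.insertNthEquiv]
    have htr : ∀ g : (Fin (m + 1) → Ω) → ℝ, ∫ ω, g ω ∂(Measure.pi fun _ : Fin (m + 1) => P)
        = ∫ p, g (e p) ∂(P.prod (Measure.pi fun _ : Fin m => P)) := fun g =>
      (hmp.integral_comp e.measurableEmbedding g).symm
    have hDi : ∀ i, Integrable (fun p => D i (e p)) (P.prod (Measure.pi fun _ : Fin m => P)) :=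
      fun i => integrable_of_mem_Icc ((hD i).comp e.measurable) fun p => abs_le.1 (hDB i _)
    have hent : ent (Measure.pi fun _ : Fin (m + 1) => P) Y
        = ent (P.prod (Measure.pi fun _ : Fin m => P)) (fun p => Y (e p)) := by
      simp only [ent, htr]
    rw [hent, Fin.sum_univ_succ, htr]
    have hsum : ∑ i : Fin m, ∫ ω, D i.succ ω ∂(Measure.pi fun _ : Fin (m + 1) => P)
        = ∫ a, ∑ i : Fin m, ∫ b, D i.succ (e (a, b)) ∂(Measure.pi fun _ : Fin m => P) ∂P := by
      rw [integral_finsetSum _ fun i _ => (hDi i.succ).integral_prod_left]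
      refine Finset.sum_congr rfl fun i _ => ?_
      rw [htr, integral_prod _ (hDi i.succ)]
    rw [hsum]
    refine ent_prod_le hc (hY.comp e.measurable) (fun p => hb _) (hDi 0)
      (integrable_finsetSum _ fun i _ => (hDi i.succ).integral_prod_left) ?_ ?_
    · intro b
      obtain ⟨a⟩ : Nonempty Ω := P.nonempty_of_neZero
      simpa [hee, Fin.update_cons_zero] using h 0 (Fin.cons a b)
    · intro a
      refine ih (D := fun i b => D i.succ (e (a, b))) hc
        ((hY.comp e.measurable).comp measurable_prodMk_left) (fun _ => hb _)
        (fun i => ((hD i.succ).comp e.measurable).comp measurable_prodMk_left)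
        (fun i b => hDB _ _) fun i b => ?_
      simpa [hee, Fin.cons_update] using h i.succ (Fin.cons a b)

end Entropy

/-! ### Scalar inequalities for the one-coordinate estimate. -/

/-- The derivative is `l² (1 - d) e^{-ld}`. Monotonicity allows an increment `d` to be replaced by a
lower bound for it. -/
theorem monotoneOn_one_sub_add_mul_exp {l : ℝ} (hl : 0 ≤ l) :
    MonotoneOn (fun d : ℝ => (1 - l + l * d) * Real.exp (-(l * d))) (Set.Iic 1) := by
  have hd : ∀ d : ℝ, HasDerivAt (fun d : ℝ => (1 - l + l * d) * Real.exp (-(l * d)))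
      (l * l * (1 - d) * Real.exp (-(l * d))) d := by
    intro d
    have h1 : HasDerivAt (fun d : ℝ => l * d) l d := by
      simpa using (hasDerivAt_id d).const_mul l
    exact ((h1.const_add (1 - l)).mul h1.neg.exp).congr_deriv (by simp only [Pi.neg_apply]; ring)
  refine monotoneOn_of_deriv_nonneg (convex_Iic 1)
    (fun d _ => (hd d).continuousAt.continuousWithinAt)
    (fun d _ => (hd d).differentiableAt.differentiableWithinAt) fun d hd' => ?_
  rw [(hd d).deriv]
  rw [interior_Iic] at hd'
  have : 0 ≤ 1 - d := by linarith [Set.mem_Iio.1 hd']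
  positivity

theorem sinh_le_add_cube {x : ℝ} (h0 : 0 ≤ x) (h1 : x ≤ 1 / 2) :
    Real.sinh x ≤ x + x ^ 3 / 5 := by
  have h : |x| ≤ 1 := by rw [abs_of_nonneg h0]; linarith
  have h' : |-x| ≤ 1 := by rwa [abs_neg]
  have e1 := (abs_le.1 (Real.exp_bound h (n := 5) (by norm_num))).2
  have e2 := (abs_le.1 (Real.exp_bound h' (n := 5) (by norm_num))).1
  rw [abs_neg] at e2
  rw [abs_of_nonneg h0] at e1 e2
  simp [Finset.sum_range_succ, Nat.factorial] at e1 e2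
  rw [Real.sinh_eq]
  have : x ^ 5 ≤ x ^ 3 * (1 / 4) := by
    have : x ^ 2 ≤ 1 / 4 := by nlinarith
    have h3 : 0 ≤ x ^ 3 := by positivity
    nlinarith
  nlinarith [pow_nonneg h0 3]

/-- The range `s ≤ 2/5` is what `lossConst_le` provides; `2/5` is the value of `lossConst` at `l =
1/2`. -/
theorem neg_log_one_sub_le {s : ℝ} (h0 : 0 ≤ s) (h1 : s ≤ 2 / 5) :
    -Real.log (1 - s) ≤ s + s ^ 2 := by
  have h : |s| < 1 := by rw [abs_of_nonneg h0]; linarith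
  have e := (abs_le.1 (Real.abs_log_sub_add_sum_range_le h 3)).1
  rw [abs_of_nonneg h0] at e
  simp [Finset.sum_range_succ] at e
  have : s ^ 4 / (1 - s) ≤ s ^ 2 * (4 / 15) := by
    rw [div_le_iff₀ (by linarith)]
    have : s ^ 2 ≤ 4 / 15 * (1 - s) := by nlinarith
    nlinarith [mul_le_mul_of_nonneg_left this (sq_nonneg s)]
  norm_num at e
  nlinarith [mul_le_mul_of_nonneg_left h1 (sq_nonneg s)]

/-- The constant `(l²/2 + l³/2 + l⁴/5) / (1 - l)`: the loss of the one-coordinate estimate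
`one_sub_lossConst_mul_le`. -/
noncomputable def lossConst (l : ℝ) : ℝ := (l ^ 2 / 2 + l ^ 3 / 2 + l ^ 4 / 5) / (1 - l)

theorem lossConst_nonneg {l : ℝ} (h0 : 0 ≤ l) (h1 : l ≤ 1 / 2) : 0 ≤ lossConst l :=
  div_nonneg (by positivity) (by linarith)

theorem lossConst_le {l : ℝ} (h0 : 0 ≤ l) (h1 : l ≤ 1 / 2) : lossConst l ≤ 2 / 5 := by
  rw [lossConst, div_le_iff₀ (by linarith)]
  have h2 : l ^ 2 ≤ 1 / 4 := by nlinarith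
  have h3 : l ^ 3 ≤ 1 / 8 := by
    calc l ^ 3 ≤ (1 / 2) ^ 3 := pow_le_pow_left₀ h0 h1 3
      _ = 1 / 8 := by norm_num
  have h4 : l ^ 4 ≤ 1 / 16 := by
    calc l ^ 4 ≤ (1 / 2) ^ 4 := pow_le_pow_left₀ h0 h1 4
      _ = 1 / 16 := by norm_num
  linarith

/-- The right side is `l² e^{-l}` times the derivative of `e^l (l/2 + l³/2)`, the form that
integrates exactly in `le_of_differential_inequality`. With `k` the numerator of `lossConst l`, `k ≤
4l²/5` makes the quartic terms at most `1/5 + 32/25 < 3/2`. -/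
theorem one_sub_mul_lossConst_add_sq_le {l : ℝ} (h0 : 0 ≤ l) (h1 : l ≤ 1 / 2) :
    (1 - l) * (lossConst l + lossConst l ^ 2) ≤ l ^ 2 / 2 * (1 + l + 3 * l ^ 2 + l ^ 3) := by
  have hl : 0 < 1 - l := by linarith
  set k := l ^ 2 / 2 + l ^ 3 / 2 + l ^ 4 / 5 with hk
  have hkk : (1 - l) * (lossConst l + lossConst l ^ 2) = k + k ^ 2 / (1 - l) := by
    rw [lossConst, ← hk]; field_simp
  have hk2 : k ^ 2 / (1 - l) ≤ 2 * k ^ 2 := by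
    rw [div_le_iff₀ hl]; nlinarith [sq_nonneg k]
  have hk3 : k ≤ l ^ 2 * (4 / 5) := by
    have : 1 / 2 + l / 2 + l ^ 2 / 5 ≤ 4 / 5 := by nlinarith
    calc k = l ^ 2 * (1 / 2 + l / 2 + l ^ 2 / 5) := by rw [hk]; ring
      _ ≤ _ := mul_le_mul_of_nonneg_left this (sq_nonneg l)
  have hk4 : k ^ 2 ≤ (l ^ 2 * (4 / 5)) ^ 2 :=
    pow_le_pow_left₀ (by rw [hk]; positivity) hk3 2
  rw [hkk]
  have : 0 ≤ l ^ 5 := by positivity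
  have : 0 ≤ l ^ 4 := by positivity
  nlinarith

/-- Symmetrized lower bound for `(1 - l + l d) e^{-l d}` at `d = y` and `d = -y`. -/
theorem le_cosh_sub_mul_sinh {l y : ℝ} (h0 : 0 ≤ l) (h1 : l ≤ 1 / 2) (hy : |y| ≤ 1) :
    (1 - l) * (1 - lossConst l * y ^ 2) ≤
      ((1 - l + l * y) * Real.exp (-(l * y)) + (1 - l + l * -y) * Real.exp (-(l * -y))) / 2 := by
  have hl : (1 - l) ≠ 0 := by linarith
  have e : ((1 - l + l * y) * Real.exp (-(l * y)) + (1 - l + l * -y) * Real.exp (-(l * -y))) / 2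
      = (1 - l) * Real.cosh (l * |y|) - l * (|y| * Real.sinh (l * |y|)) := by
    rcases abs_cases y with ⟨h, _⟩ | ⟨h, _⟩ <;>
    · rw [h, Real.cosh_eq, Real.sinh_eq]; simp only [mul_neg, neg_neg]; ring
  rw [e, ← sq_abs y]
  set t := |y|
  have ht : 0 ≤ t := abs_nonneg y
  have hc : 1 + (l * t) ^ 2 / 2 ≤ Real.cosh (l * t) := by
    have hx : 0 ≤ l * t / 2 := by positivity
    have h2 := Real.cosh_two_mul (l * t / 2)
    rw [Real.cosh_sq, mul_div_cancel₀ _ (two_ne_zero)] at h2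
    have := pow_le_pow_left₀ hx (Real.self_le_sinh_iff.2 hx) 2
    linarith
  have hs := sinh_le_add_cube (x := l * t) (by positivity) (by nlinarith)
  have hs' : t * Real.sinh (l * t) ≤ t ^ 2 * (l + l ^ 3 / 5) := by
    have h4 : t ^ 4 ≤ t ^ 2 := pow_le_pow_of_le_one ht hy (by norm_num)
    have := mul_le_mul_of_nonneg_left hs ht
    have h3 : 0 ≤ l ^ 3 / 5 := by positivity
    nlinarith [mul_le_mul_of_nonneg_left h4 h3]
  have hk : (1 - l) * lossConst l = l ^ 2 / 2 + l ^ 3 / 2 + l ^ 4 / 5 := by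
    rw [lossConst]; field_simp
  have := mul_le_mul_of_nonneg_left hs' h0
  have := mul_le_mul_of_nonneg_left hc (by linarith : 0 ≤ 1 - l)
  have : (1 - l) * (1 - lossConst l * t ^ 2)
    = (1 - l) - (l ^ 2 / 2 + l ^ 3 / 2 + l ^ 4 / 5) * t ^ 2 := by rw [← hk]; ring
  nlinarith

theorem integral_rademacher (g : ℤˣ → ℝ) : ∫ u, g u ∂rademacher = (g 1 + g (-1)) / 2 := by
  rw [rademacher, integral_smul_measure, integral_add_measure Integrable.of_finite
    Integrable.of_finite, integral_dirac, integral_dirac]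
  simp
  ring

theorem abs_unit_mul (u : ℤˣ) (x : ℝ) : |((u : ℤ) : ℝ) * x| = |x| := by
  rcases Int.units_eq_one_or u with rfl | rfl <;> simp

/-! ### The entropy of one coordinate. -/

section Coordinate

variable {X : Type*} [MeasurableSpace X] {μ : Measure X} [IsProbabilityMeasure μ]

/-- Shifting `y` by `ε` costs at most `l ε e^{-l(y - ε)}`; the exponent is at most `1` and `l ≤
1/2`, whence `2ε`. -/
theorem sub_le_one_sub_add_mul_exp {l y d ε : ℝ} (h0 : 0 ≤ l) (h1 : l ≤ 1 / 2) (hy : |y| ≤ 1)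
    (hd : d ≤ 1) (hε : 0 ≤ ε) (hε1 : ε ≤ 1) (h : y - ε ≤ d) :
    (1 - l + l * y) * Real.exp (-(l * y)) - 2 * ε ≤ (1 - l + l * d) * Real.exp (-(l * d)) := by
  obtain ⟨hy1, hy2⟩ := abs_le.1 hy
  refine le_trans ?_ (monotoneOn_one_sub_add_mul_exp h0 (Set.mem_Iic.2 (h.trans hd))
    (Set.mem_Iic.2 hd) h)
  have e1 : Real.exp (-(l * y)) ≤ Real.exp (-(l * (y - ε))) := Real.exp_le_exp.2 (by nlinarith)
  have e2 : Real.exp (-(l * (y - ε))) ≤ 4 :=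
    (Real.exp_le_exp.2 (by nlinarith : -(l * (y - ε)) ≤ 1)).trans
      (by linarith [Real.exp_one_lt_d9])
  have e3 := mul_le_mul_of_nonneg_left e1 (by nlinarith : 0 ≤ 1 - l + l * y)
  have e4 := mul_le_mul_of_nonneg_left e2 (mul_nonneg h0 hε)
  have e5 := mul_le_mul_of_nonneg_right h1 hε
  simp only
  nlinarith

/-- By monotonicity `d` may be replaced by `σ f(x)` at a vanishing cost. Averaging over `σ = ±1`
cancels the odd terms, and what remains is controlled by `∫ f² ≤ s`. -/
theorem one_sub_lossConst_mul_le {d : X × ℤˣ → ℝ} {l s : ℝ} (h0 : 0 ≤ l) (h1 : l ≤ 1 / 2)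
    (hdm : Measurable d) (hd : ∀ p, d p ∈ Set.Icc (-1) 1)
    (hf : ∀ ε > 0, ∃ f : X → ℝ, Measurable f ∧ (∀ x, |f x| ≤ 1) ∧ ∫ x, f x ^ 2 ∂μ ≤ s ∧
      ∀ p, ((p.2 : ℤ) : ℝ) * f p.1 - ε ≤ d p) :
    (1 - l) * (1 - lossConst l * s) ≤
      ∫ p, (1 - l + l * d p) * Real.exp (-(l * d p)) ∂(μ.prod rademacher) := by
  have hexpint : ∀ {W : X × ℤˣ → ℝ}, Measurable W → (∀ p, W p ∈ Set.Icc (-1) 1) →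
      Integrable (fun p => (1 - l + l * W p) * Real.exp (-(l * W p))) (μ.prod rademacher) := by
    intro W hW hWb
    refine integrable_of_mem_Icc (c := 0) (C := 1 * Real.exp 1) (by fun_prop) fun p => ?_
    obtain ⟨ha, hb⟩ := hWb p
    refine ⟨mul_nonneg (by nlinarith) (Real.exp_pos _).le,
      mul_le_mul (by nlinarith) (Real.exp_le_exp.2 (by nlinarith)) (Real.exp_pos _).le
        zero_le_one⟩
  refine le_of_forall_pos_le_add fun ε hε => ?_
  obtain ⟨f, hfm, hf1, hfs, hfd⟩ := hf (min 1 (ε / 2)) (by positivity)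
  have hgm : Measurable fun p : X × ℤˣ => ((p.2 : ℤ) : ℝ) * f p.1 :=
    ((Measurable.of_discrete (f := fun u : ℤˣ => ((u : ℤ) : ℝ))).comp measurable_snd).mul
      (hfm.comp measurable_fst)
  have hgb : ∀ p : X × ℤˣ, ((p.2 : ℤ) : ℝ) * f p.1 ∈ Set.Icc (-1 : ℝ) 1 := fun p =>
    abs_le.1 ((abs_unit_mul _ _).trans_le (hf1 _))
  have hig := hexpint hgm hgb
  have hmono := integral_mono (hig.sub (integrable_const ε)) (hexpint hdm hd) fun p => by
    have := sub_le_one_sub_add_mul_exp h0 h1 (abs_le.2 (hgb p)) (hd p).2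
      (by positivity) (min_le_left 1 (ε / 2)) (hfd p)
    have h2 := min_le_right 1 (ε / 2)
    simp only [Pi.sub_apply]
    linarith
  rw [integral_sub' hig (integrable_const ε), integral_prod _ hig] at hmono
  simp only [integral_rademacher, integral_const, probReal_univ, one_smul] at hmono
  have hi2 : Integrable (fun x => f x ^ 2) μ :=
    integrable_of_mem_Icc (c := 0) (C := 1) (hfm.pow_const 2) fun x =>
      ⟨sq_nonneg _, by rw [← sq_abs]; exact pow_le_one₀ (abs_nonneg _) (hf1 x)⟩
  have hsym : ∫ x, (1 - l) * (1 - lossConst l * f x ^ 2) ∂μ ≤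
      ∫ x, ((1 - l + l * (((1 : ℤˣ) : ℤ) * f x)) * Real.exp (-(l * (((1 : ℤˣ) : ℤ) * f x)))
        + (1 - l + l * (((-1 : ℤˣ) : ℤ) * f x)) * Real.exp (-(l * (((-1 : ℤˣ) : ℤ) * f x)))) / 2
        ∂μ := by
    refine integral_mono (((integrable_const _).sub (hi2.const_mul _)).const_mul _) ?_ fun x => ?_
    · have := hig.integral_prod_left
      simpa only [integral_rademacher] using this
    · simpa using le_cosh_sub_mul_sinh h0 h1 (hf1 x)
  rw [integral_const_mul, integral_sub (integrable_const _) (hi2.const_mul _),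
    integral_const_mul] at hsym
  simp only [integral_const, probReal_univ, one_smul] at hsym
  have hK := mul_le_mul_of_nonneg_left
    (mul_le_mul_of_nonneg_left hfs (lossConst_nonneg h0 h1)) (by linarith : 0 ≤ 1 - l)
  linarith

/-- Here `W` is the supremum as a function of one coordinate and `ζ` is the supremum without it. The
bound is linear in `W - ζ`, so it can be summed over coordinates. -/
theorem ent_exp_le {W : X × ℤˣ → ℝ} {l s ζ : ℝ} (h0 : 0 ≤ l) (h1 : l ≤ 1 / 2)
    (hs1 : s ≤ 1) (hWm : Measurable W)
    (hW : ∀ p, W p - ζ ∈ Set.Icc (-1) 1)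
    (hf : ∀ ε > 0, ∃ f : X → ℝ, Measurable f ∧ (∀ x, |f x| ≤ 1) ∧ ∫ x, f x ^ 2 ∂μ ≤ s ∧
      ∀ p, ((p.2 : ℤ) : ℝ) * f p.1 - ε ≤ W p - ζ) :
    ent (μ.prod rademacher) (fun p => Real.exp (-(l * W p))) ≤
      ∫ p, Real.exp (-(l * W p)) * (-Real.log (1 - lossConst l * s) + l ^ 2 / (1 - l) * (W p - ζ))
        ∂(μ.prod rademacher) := by
  have hl : 0 < 1 - l := by linarith
  have hq := one_sub_lossConst_mul_le (μ := μ) h0 h1 (hWm.sub_const ζ) hW hf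
  have hpos : 0 < 1 - lossConst l * s := by
    nlinarith [lossConst_nonneg h0 h1, lossConst_le h0 h1]
  set A := Real.log (1 - lossConst l * s)
  have hYm : Measurable fun p => Real.exp (-(l * W p)) := by fun_prop
  have hYb : ∀ p, Real.exp (-(l * W p)) ∈
      Set.Icc (Real.exp (-(l * (ζ + 1)))) (Real.exp (-(l * (ζ - 1)))) := by
    intro p
    obtain ⟨ha, hb⟩ := hW p
    exact ⟨Real.exp_le_exp.2 (by nlinarith), Real.exp_le_exp.2 (by nlinarith)⟩
  have hiY : Integrable (fun p => Real.exp (-(l * W p))) (μ.prod rademacher) :=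
    integrable_of_mem_Icc hYm hYb
  have hiYd : Integrable (fun p => Real.exp (-(l * W p)) * (W p - ζ)) (μ.prod rademacher) :=
    hiY.mul_bdd (c := 1) (hWm.sub_const ζ).aestronglyMeasurable
      (ae_of_all _ fun p => abs_le.2 (hW p))
  -- The reference value is `u = (1 - lossConst l * s) e^{-lζ}`: `log u` cancels the `ζ` term of
  -- `log Y`, and `hq` bounds `u` by `M + l/(1-l) N`.
  have hent := ent_le_integral (P := μ.prod rademacher) (Real.exp_pos _) hYm hYb
    (mul_pos hpos (Real.exp_pos (-(l * ζ))))
  refine hent.trans ?_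
  rw [Real.log_mul hpos.ne' (Real.exp_pos _).ne', Real.log_exp]
  have e1 : ∫ p, Real.exp (-(l * W p)) * Real.log (Real.exp (-(l * W p))) ∂(μ.prod rademacher)
      = -l * ∫ p, Real.exp (-(l * W p)) * (W p - ζ) ∂(μ.prod rademacher)
        - l * ζ * ∫ p, Real.exp (-(l * W p)) ∂(μ.prod rademacher) := by
    rw [← integral_const_mul, ← integral_const_mul,
      ← integral_sub (hiYd.const_mul _) (hiY.const_mul _)]
    congr 1; ext p; rw [Real.log_exp]; ring
  have e2 : ∫ p, Real.exp (-(l * W p)) * (-A + l ^ 2 / (1 - l) * (W p - ζ)) ∂(μ.prod rademacher)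
      = -A * ∫ p, Real.exp (-(l * W p)) ∂(μ.prod rademacher)
        + l ^ 2 / (1 - l) * ∫ p, Real.exp (-(l * W p)) * (W p - ζ) ∂(μ.prod rademacher) := by
    rw [← integral_const_mul, ← integral_const_mul,
      ← integral_add (hiY.const_mul _) (hiYd.const_mul _)]
    congr 1; ext p; ring
  have e3 : Real.exp (-(l * ζ)) * ∫ p, (1 - l + l * (W p - ζ)) * Real.exp (-(l * (W p - ζ)))
      ∂(μ.prod rademacher) = (1 - l) * ∫ p, Real.exp (-(l * W p)) ∂(μ.prod rademacher)
        + l * ∫ p, Real.exp (-(l * W p)) * (W p - ζ) ∂(μ.prod rademacher) := by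
    rw [← integral_const_mul, ← integral_const_mul, ← integral_const_mul,
      ← integral_add (hiY.const_mul _) (hiYd.const_mul _)]
    congr 1; ext p
    have : Real.exp (-(l * W p)) = Real.exp (-(l * ζ)) * Real.exp (-(l * (W p - ζ))) := by
      rw [← Real.exp_add]; congr 1; ring
    rw [this]; ring
  have hq' := mul_le_mul_of_nonneg_left hq (Real.exp_pos (-(l * ζ))).le
  rw [e3] at hq'
  rw [e1, e2]
  set M := ∫ p, Real.exp (-(l * W p)) ∂(μ.prod rademacher)
  set N := ∫ p, Real.exp (-(l * W p)) * (W p - ζ) ∂(μ.prod rademacher)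
  have hq'' : (1 - lossConst l * s) * Real.exp (-(l * ζ)) ≤ M + l / (1 - l) * N := by
    rw [← mul_le_mul_iff_right₀ hl]
    calc _ = Real.exp (-(l * ζ)) * ((1 - l) * (1 - lossConst l * s)) := by ring
      _ ≤ _ := hq'
      _ = _ := by field_simp
  have hC : l / (1 - l) * N = l * N + l ^ 2 / (1 - l) * N := by field_simp; ring
  linarith

end Coordinate

/-! ### From the differential inequality to a bound on the log-Laplace transform. -/

open Filter Topology in
/-- Integration of the differential inequality satisfied by a log-Laplace transform. -/
theorem le_of_differential_inequality {G : ℝ → ℝ} {E n : ℝ} (hn : 0 ≤ n)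
    (hG : Differentiable ℝ G) (hG0 : G 0 = 0) (hG' : deriv G 0 = -E)
    (h : ∀ l, 0 < l → l ≤ 1 / 2 →
      l / (1 - l) * deriv G l - G l ≤ n * (lossConst l + lossConst l ^ 2))
    {l : ℝ} (hl : 0 < l) (hl1 : l ≤ 1 / 2) :
    G l ≤ -(l * Real.exp (-l) * E) + n * (l ^ 2 / 2 + l ^ 4 / 2) := by
  -- Since `(e^x G/x)' = e^x (x G' - (1-x) G)/x²`, the factor `e^x / x` integrates the left side.
  -- The subtracted term is a primitive of the bound on the right, so `φ` decreases from its limit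
  -- `-E` at `0`.
  set φ : ℝ → ℝ := fun x => Real.exp x * (x⁻¹ * G x - n * (x / 2 + x ^ 3 / 2)) with hφ
  have hd : ∀ x, x ≠ 0 → HasDerivAt φ (Real.exp x * (x⁻¹ * G x - n * (x / 2 + x ^ 3 / 2))
      + Real.exp x * (-(x ^ 2)⁻¹ * G x + x⁻¹ * deriv G x - n * (1 / 2 + 3 * x ^ 2 / 2))) x := by
    intro x hx
    have h1 : HasDerivAt (fun x : ℝ => n * (x / 2 + x ^ 3 / 2)) (n * (1 / 2 + 3 * x ^ 2 / 2)) x := by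
      refine ((((hasDerivAt_id x).div_const 2).add
        ((hasDerivAt_pow 3 x).div_const 2)).const_mul n).congr_deriv ?_
      norm_num
    exact (Real.hasDerivAt_exp x).mul
      (((hasDerivAt_inv hx).mul (hG x).hasDerivAt).sub h1)
  have hanti : AntitoneOn φ (Set.Ioc 0 (1 / 2)) := by
    refine antitoneOn_of_deriv_nonpos (convex_Ioc _ _)
      (fun x hx => (hd x hx.1.ne').continuousAt.continuousWithinAt)
      (fun x hx => (hd x (interior_subset hx).1.ne').differentiableAt.differentiableWithinAt)
      fun x hx => ?_
    obtain ⟨hx0, hx1⟩ := interior_subset hx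
    rw [(hd x hx0.ne').deriv, ← mul_add]
    refine mul_nonpos_of_nonneg_of_nonpos (Real.exp_pos x).le ?_
    have hx2 : 0 < 1 - x := by linarith
    have e1 := mul_le_mul_of_nonneg_left (h x hx0 hx1) hx2.le
    have e2 := mul_le_mul_of_nonneg_left (one_sub_mul_lossConst_add_sq_le hx0.le hx1) hn
    have e3 : (1 - x) * (x / (1 - x) * deriv G x - G x)
        = x * deriv G x - (1 - x) * G x := by field_simp
    have e4 : x⁻¹ * G x - n * (x / 2 + x ^ 3 / 2)
        + (-(x ^ 2)⁻¹ * G x + x⁻¹ * deriv G x - n * (1 / 2 + 3 * x ^ 2 / 2))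
        = (x ^ 2)⁻¹ * (x * deriv G x - (1 - x) * G x
          - n * (x ^ 2 / 2 * (1 + x + 3 * x ^ 2 + x ^ 3))) := by field_simp; ring
    rw [e4]
    refine mul_nonpos_of_nonneg_of_nonpos (by positivity) ?_
    linarith
  have hlim : Tendsto φ (𝓝[>] 0) (𝓝 (-E)) := by
    have t1 : Tendsto (fun x => x⁻¹ * G x) (𝓝[>] 0) (𝓝 (-E)) := by
      have := (hG 0).hasDerivAt.tendsto_slope_zero_right
      simpa [hG0, hG'] using this
    have t2 : Tendsto (fun x : ℝ => n * (x / 2 + x ^ 3 / 2)) (𝓝[>] 0) (𝓝 0) := by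
      have : Continuous fun x : ℝ => n * (x / 2 + x ^ 3 / 2) := by fun_prop
      have := this.tendsto 0
      norm_num at this
      exact this.mono_left nhdsWithin_le_nhds
    have t3 : Tendsto Real.exp (𝓝[>] 0) (𝓝 1) := by
      have := Real.continuous_exp.tendsto 0
      rw [Real.exp_zero] at this
      exact this.mono_left nhdsWithin_le_nhds
    simpa using t3.mul (t1.sub t2)
  have hle : φ l ≤ -E := by
    refine ge_of_tendsto hlim ?_
    filter_upwards [Ioo_mem_nhdsGT hl] with x hx
    exact hanti ⟨hx.1, hx.2.le.trans hl1⟩ ⟨hl, hl1⟩ hx.2.le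
  have := mul_le_mul_of_nonneg_left hle (mul_pos hl (Real.exp_pos (-l))).le
  have e : l * Real.exp (-l) * φ l = G l - n * (l ^ 2 / 2 + l ^ 4 / 2) := by
    have : Real.exp (-l) * Real.exp l = 1 := by rw [← Real.exp_add]; simp
    calc _ = (Real.exp (-l) * Real.exp l) * (l * (l⁻¹ * G l - n * (l / 2 + l ^ 3 / 2))) := by
          rw [hφ]; ring
      _ = _ := by rw [this]; field_simp
  rw [e] at this
  linarith

/-- Expanding `e^{-l}` leaves an excess `l⁴ (2E + n)/2` over the quadratic term and a gain `l³ E/2`;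
the hypothesis says that the gain covers the excess. -/
theorem neg_mul_exp_add_le {E n l : ℝ} (hE : 0 ≤ E) (hl : 0 ≤ l) (hl1 : l ≤ 1 / 2)
    (h : l * (2 * E + n) ≤ E) :
    -(l * Real.exp (-l) * E) + n * (l ^ 2 / 2 + l ^ 4 / 2) + l * E ≤ l ^ 2 * (2 * E + n) / 2 := by
  have hb : |-l| ≤ 1 := by rw [abs_neg, abs_of_nonneg hl]; linarith
  have e := (abs_le.1 (Real.exp_bound hb (n := 3) (by norm_num))).1
  rw [abs_neg, abs_of_nonneg hl] at e
  simp [Finset.sum_range_succ, Nat.factorial] at e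
  have e' : 1 - l + l ^ 2 / 2 - l ^ 3 ≤ Real.exp (-l) := by
    nlinarith [pow_nonneg hl 3]
  have h1 := mul_le_mul_of_nonneg_left e' (mul_nonneg hl hE)
  have h2 := mul_le_mul_of_nonneg_left h (by positivity : 0 ≤ l ^ 3 / 2)
  nlinarith

/-- The supremum over a family `g` of the signed sums `∑ i, ε i * g (x i)`. -/
noncomputable def radSup {X ι : Type*} (g : ι → X → ℝ) {k : ℕ} (ω : Fin k → X × ℤˣ) : ℝ :=
  ⨆ j, ∑ i, (((ω i).2 : ℤ) : ℝ) * g j (ω i).1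

/-! ### Suprema of signed sums and their lower tail. -/

section RadSup

variable {X ι : Type*} {g : ι → X → ℝ}

theorem sum_le_radSup (hg : ∀ j x, |g j x| ≤ 1) {k : ℕ} (ω : Fin k → X × ℤˣ) (j : ι) :
    ∑ i, (((ω i).2 : ℤ) : ℝ) * g j (ω i).1 ≤ radSup g ω := by
  refine le_ciSup (f := fun j => ∑ i, (((ω i).2 : ℤ) : ℝ) * g j (ω i).1) ⟨k, ?_⟩ j
  rintro _ ⟨j, rfl⟩
  calc ∑ i, (((ω i).2 : ℤ) : ℝ) * g j (ω i).1 ≤ ∑ _i : Fin k, (1 : ℝ) :=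
        Finset.sum_le_sum fun i _ => (le_abs_self _).trans ((abs_unit_mul _ _).trans_le (hg j _))
    _ = k := by simp

theorem radSup_le [Nonempty ι] (hg : ∀ j x, |g j x| ≤ 1) {k : ℕ} (ω : Fin k → X × ℤˣ) :
    radSup g ω ≤ k :=
  ciSup_le fun j =>
    calc ∑ i, (((ω i).2 : ℤ) : ℝ) * g j (ω i).1 ≤ ∑ _i : Fin k, (1 : ℝ) :=
        Finset.sum_le_sum fun i _ => (le_abs_self _).trans ((abs_unit_mul _ _).trans_le (hg j _))
      _ = k := by simp

theorem radSup_nonneg (hg : ∀ j x, |g j x| ≤ 1) (h0 : ∃ j, ∀ x, g j x = 0) {k : ℕ}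
    (ω : Fin k → X × ℤˣ) : 0 ≤ radSup g ω := by
  obtain ⟨j, hj⟩ := h0
  simpa [hj] using sum_le_radSup hg ω j

theorem exists_radSup_le_add [Nonempty ι] {k : ℕ} (ω : Fin k → X × ℤˣ) {ε : ℝ} (hε : 0 < ε) :
    ∃ j, radSup g ω ≤ ∑ i, (((ω i).2 : ℤ) : ℝ) * g j (ω i).1 + ε := by
  obtain ⟨j, hj⟩ := exists_lt_of_lt_ciSup (show radSup g ω - ε <
    ⨆ j, ∑ i, (((ω i).2 : ℤ) : ℝ) * g j (ω i).1 from sub_lt_self _ hε)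
  exact ⟨j, by linarith⟩

theorem radSup_sub_mem_Icc [Nonempty ι] (hg : ∀ j x, |g j x| ≤ 1) {k : ℕ}
    (ω : Fin (k + 1) → X × ℤˣ) (i : Fin (k + 1)) :
    radSup g ω - radSup g (fun t => ω (i.succAbove t)) ∈ Set.Icc (-1) 1 := by
  have hb : ∀ j, (((ω i).2 : ℤ) : ℝ) * g j (ω i).1 ∈ Set.Icc (-1 : ℝ) 1 := fun j =>
    abs_le.1 ((abs_unit_mul _ _).trans_le (hg j _))
  constructor
  · have : radSup g (fun t => ω (i.succAbove t)) ≤ radSup g ω + 1 := by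
      refine ciSup_le fun j => ?_
      have := sum_le_radSup hg ω j
      rw [Fin.sum_univ_succAbove _ i] at this
      linarith [(hb j).1]
    linarith
  · have : radSup g ω ≤ radSup g (fun t => ω (i.succAbove t)) + 1 := by
      refine ciSup_le fun j => ?_
      rw [Fin.sum_univ_succAbove _ i]
      linarith [(hb j).2, sum_le_radSup hg (fun t => ω (i.succAbove t)) j]
    linarith

/-- Self-bounding: a single near-maximizer of the full sum is a competitor in every leave-one-out
supremum, so each difference is at most its own summand plus `ε / (k + 1)`. -/
theorem sum_radSup_sub_le [Nonempty ι] (hg : ∀ j x, |g j x| ≤ 1) {k : ℕ}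
    (ω : Fin (k + 1) → X × ℤˣ) :
    ∑ i : Fin (k + 1), (radSup g ω - radSup g (fun t => ω (i.succAbove t))) ≤ radSup g ω := by
  refine le_of_forall_pos_le_add fun ε hε => ?_
  obtain ⟨j, hj⟩ := exists_radSup_le_add (g := g) ω (ε := ε / (k + 1)) (by positivity)
  calc ∑ i : Fin (k + 1), (radSup g ω - radSup g (fun t => ω (i.succAbove t)))
      ≤ ∑ i : Fin (k + 1), ((((ω i).2 : ℤ) : ℝ) * g j (ω i).1 + ε / (k + 1)) := by
        refine Finset.sum_le_sum fun i _ => ?_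
        have := sum_le_radSup hg (fun t => ω (i.succAbove t)) j
        rw [Fin.sum_univ_succAbove _ i] at hj
        linarith
    _ = ∑ i, (((ω i).2 : ℤ) : ℝ) * g j (ω i).1 + ε := by
        rw [Finset.sum_add_distrib]
        simp
        field_simp
    _ ≤ radSup g ω + ε := by linarith [sum_le_radSup hg ω j]

variable [MeasurableSpace X] {μ : Measure X} [IsProbabilityMeasure μ]

theorem ent_exp_radSup_le [Nonempty ι] (hg : ∀ j x, |g j x| ≤ 1) (hgm : ∀ j, Measurable (g j))
    (hm : ∀ k, Measurable (radSup g : (Fin k → X × ℤˣ) → ℝ)) {s : ℝ} (hs1 : s ≤ 1)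
    (hs : ∀ j, ∫ x, g j x ^ 2 ∂μ ≤ s) {l : ℝ} (h0 : 0 ≤ l) (h1 : l ≤ 1 / 2)
    (h0g : ∃ j, ∀ x, g j x = 0) (k : ℕ) :
    ent (Measure.pi fun _ : Fin (k + 1) => μ.prod rademacher)
        (fun ω => Real.exp (-(l * radSup g ω))) ≤
      ∫ ω, Real.exp (-(l * radSup g ω)) * ((k + 1) * -Real.log (1 - lossConst l * s)
        + l ^ 2 / (1 - l) * radSup g ω) ∂(Measure.pi fun _ : Fin (k + 1) => μ.prod rademacher) := by
  set A := -Real.log (1 - lossConst l * s)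
  have hl : 0 < 1 - l := by linarith
  have hB : 0 ≤ l ^ 2 / (1 - l) := by positivity
  set D : Fin (k + 1) → (Fin (k + 1) → X × ℤˣ) → ℝ := fun i ω =>
    Real.exp (-(l * radSup g ω)) * (A + l ^ 2 / (1 - l) *
      (radSup g ω - radSup g (fun t => ω (i.succAbove t)))) with hD
  have hDm : ∀ i, Measurable (D i) := by
    intro i
    have h2 : Measurable fun ω : Fin (k + 1) → X × ℤˣ => radSup g (fun t => ω (i.succAbove t)) :=
      (hm k).comp (measurable_pi_lambda _ fun t => measurable_pi_apply _)
    have h3 := hm (k + 1)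
    simp only [hD]
    fun_prop
  have hYb : ∀ ω : Fin (k + 1) → X × ℤˣ, Real.exp (-(l * radSup g ω)) ∈
      Set.Icc (Real.exp (-(l * (k + 1)))) 1 := by
    intro ω
    have h2 := radSup_nonneg hg h0g ω
    have h3 := radSup_le hg ω
    push_cast at h3
    exact ⟨Real.exp_le_exp.2 (by nlinarith), Real.exp_le_one_iff.2 (by nlinarith)⟩
  have hDb : ∀ i ω, |D i ω| ≤ 1 * (|A| + l ^ 2 / (1 - l) * 1) := by
    intro i ω
    simp only [hD]
    rw [abs_mul, abs_of_pos (Real.exp_pos _)]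
    refine mul_le_mul (hYb ω).2 ((abs_add_le _ _).trans (add_le_add_right ?_ _))
      (abs_nonneg _) zero_le_one
    rw [abs_mul, abs_of_nonneg hB]
    exact mul_le_mul_of_nonneg_left (abs_le.2 (radSup_sub_mem_Icc hg ω i)) hB
  have hZm := hm (k + 1)
  have hYm : Measurable fun ω : Fin (k + 1) → X × ℤˣ => Real.exp (-(l * radSup g ω)) := by
    fun_prop
  have hDi : ∀ i, Integrable (D i) (Measure.pi fun _ : Fin (k + 1) => μ.prod rademacher) :=
    fun i => integrable_of_mem_Icc (hDm i) fun ω => abs_le.1 (hDb i ω)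
  refine (ent_pi_le (P := μ.prod rademacher) (k + 1) (Real.exp_pos _) hYm hYb hDm hDb
    fun i ω => ?_).trans ?_
  · have hup : ∀ p t, Function.update ω i p (i.succAbove t) = ω (i.succAbove t) := fun p t =>
      Function.update_of_ne (Fin.succAbove_ne i t) _ _
    simp only [hD, hup]
    refine ent_exp_le h0 h1 hs1 (hZm.comp (measurable_update ω)) (fun p => ?_) fun ε hε => ?_
    · simpa only [hup] using radSup_sub_mem_Icc hg (Function.update ω i p) i
    -- The near-maximizer is chosen from the other coordinates alone, so it does not depend on the
    -- point and sign being integrated.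
    · obtain ⟨j, hj⟩ := exists_radSup_le_add (g := g) (fun t => ω (i.succAbove t)) hε
      refine ⟨g j, hgm j, hg j, hs j, fun p => ?_⟩
      have := sum_le_radSup hg (Function.update ω i p) j
      rw [Fin.sum_univ_succAbove _ i] at this
      simp only [hup, Function.update_self] at this
      linarith
  · rw [← integral_finsetSum _ fun i _ => hDi i]
    refine integral_mono (integrable_finsetSum _ fun i _ => hDi i) ?_ fun ω => ?_
    · refine (integrable_of_mem_Icc hYm hYb).mul_bdd
        (c := |(k + 1) * A| + l ^ 2 / (1 - l) * (k + 1)) (by fun_prop)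
        (ae_of_all _ fun ω => (abs_add_le _ _).trans (add_le_add_right ?_ _))
      rw [abs_mul, abs_of_nonneg hB, abs_of_nonneg (radSup_nonneg hg h0g ω)]
      exact mul_le_mul_of_nonneg_left (by simpa using radSup_le hg ω) hB
    · simp only [hD]
      rw [← Finset.mul_sum, Finset.sum_add_distrib, ← Finset.mul_sum]
      refine mul_le_mul_of_nonneg_left ?_ (Real.exp_pos _).le
      have := mul_le_mul_of_nonneg_left (sum_radSup_sub_le hg ω) hB
      simp only [Finset.sum_const, Finset.card_univ, Fintype.card_fin, nsmul_eq_mul]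
      push_cast
      linarith

-- Dividing the entropy bound by `E[exp(-tZ)]` turns it into a differential inequality for the
-- cumulant generating function, because `t + t²/(1-t) = t/(1-t)`. The condition `s ≤ 1` gives `s² ≤
-- s`, so the logarithmic term is linear in `s`.
open ProbabilityTheory in
theorem cgf_neg_radSup_le [Nonempty ι] (hg : ∀ j x, |g j x| ≤ 1) (hgm : ∀ j, Measurable (g j))
    (hm : ∀ k, Measurable (radSup g : (Fin k → X × ℤˣ) → ℝ)) {s : ℝ} (hs0 : 0 ≤ s) (hs1 : s ≤ 1)
    (hs : ∀ j, ∫ x, g j x ^ 2 ∂μ ≤ s) (h0g : ∃ j, ∀ x, g j x = 0) (k : ℕ)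
    {l : ℝ} (h0 : 0 < l) (h1 : l ≤ 1 / 2) :
    cgf (fun ω => -radSup g ω) (Measure.pi fun _ : Fin (k + 1) => μ.prod rademacher) l ≤
      -(l * Real.exp (-l) *
        ∫ ω, radSup g ω ∂(Measure.pi fun _ : Fin (k + 1) => μ.prod rademacher))
      + (k + 1) * s * (l ^ 2 / 2 + l ^ 4 / 2) := by
  set P := Measure.pi fun _ : Fin (k + 1) => μ.prod rademacher with hP
  have hZm := hm (k + 1)
  have hZb : ∀ ω : Fin (k + 1) → X × ℤˣ, -radSup g ω ∈ Set.Icc (-((k + 1 : ℕ) : ℝ)) 0 := fun ω =>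
    ⟨neg_le_neg (radSup_le hg ω), neg_nonpos.2 (radSup_nonneg hg h0g ω)⟩
  have hiexp : ∀ t : ℝ, Integrable (fun ω => Real.exp (t * -radSup g ω)) P := fun t =>
    integrable_exp_mul_of_mem_Icc hZm.neg.aemeasurable (ae_of_all _ hZb)
  have hset : interior (integrableExpSet (fun ω => -radSup g ω) P) = Set.univ := by
    have : integrableExpSet (fun ω => -radSup g ω) P = Set.univ := Set.eq_univ_of_forall hiexp
    rw [this, interior_univ]
  refine le_of_differential_inequality (by positivity)
    (fun t => (analyticAt_cgf (by rw [hset]; trivial)).differentiableAt) cgf_zero ?_ ?_ h0 h1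
  · rw [deriv_cgf_zero (by rw [hset]; trivial), integral_neg]
    simp
  · intro t ht0 ht1
    have hent := ent_exp_radSup_le (μ := μ) hg hgm hm hs1 hs ht0.le ht1 h0g k
    rw [deriv_cgf (by rw [hset]; trivial)]
    simp only [ent, cgf, mgf, mul_neg, ← hP, Real.log_exp] at hent ⊢
    have hiY : Integrable (fun ω => Real.exp (-(t * radSup g ω))) P := by
      simpa only [mul_neg] using hiexp t
    have hiYZ : Integrable (fun ω => radSup g ω * Real.exp (-(t * radSup g ω))) P := by
      refine hiY.bdd_mul (c := ((k + 1 : ℕ) : ℝ)) hZm.aestronglyMeasurable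
        (ae_of_all _ fun ω => ?_)
      rw [Real.norm_eq_abs, abs_of_nonneg (radSup_nonneg hg h0g ω)]
      exact radSup_le hg ω
    have e1 : ∫ ω, -(Real.exp (-(t * radSup g ω)) * (t * radSup g ω)) ∂P
        = -t * ∫ ω, radSup g ω * Real.exp (-(t * radSup g ω)) ∂P := by
      rw [← integral_const_mul]; congr 1; ext ω; ring
    have e2 : ∫ ω, Real.exp (-(t * radSup g ω)) * ((k + 1) * -Real.log (1 - lossConst t * s)
        + t ^ 2 / (1 - t) * radSup g ω) ∂P
        = (k + 1) * -Real.log (1 - lossConst t * s) * ∫ ω, Real.exp (-(t * radSup g ω)) ∂P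
          + t ^ 2 / (1 - t) * ∫ ω, radSup g ω * Real.exp (-(t * radSup g ω)) ∂P := by
      rw [← integral_const_mul, ← integral_const_mul,
        ← integral_add (hiY.const_mul _) (hiYZ.const_mul _)]
      congr 1; ext ω; ring
    have e3 : ∫ ω, -radSup g ω * Real.exp (-(t * radSup g ω)) ∂P
        = -∫ ω, radSup g ω * Real.exp (-(t * radSup g ω)) ∂P := by
      rw [← integral_neg]; congr 1; ext ω; ring
    have hM : 0 < ∫ ω, Real.exp (-(t * radSup g ω)) ∂P := integral_exp_pos hiY
    simp only [mul_neg] at e2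
    rw [e1, e2] at hent
    rw [e3]
    set M := ∫ ω, Real.exp (-(t * radSup g ω)) ∂P
    set N := ∫ ω, radSup g ω * Real.exp (-(t * radSup g ω)) ∂P
    have hl : 0 < 1 - t := by linarith
    have hK0 := lossConst_nonneg ht0.le ht1
    have hK1 := lossConst_le ht0.le ht1
    have hlog : -Real.log (1 - lossConst t * s) ≤ s * (lossConst t + lossConst t ^ 2) := by
      refine (neg_log_one_sub_le (by positivity) (by nlinarith)).trans ?_
      have : s ^ 2 ≤ s := by nlinarith
      nlinarith [mul_le_mul_of_nonneg_left this (sq_nonneg (lossConst t))]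
    have hC : t / (1 - t) * N = t * N + t ^ 2 / (1 - t) * N := by field_simp; ring
    have h3 : t / (1 - t) * (-N / M) - Real.log M ≤
        (k + 1) * -Real.log (1 - lossConst t * s) := by
      rw [← mul_le_mul_iff_right₀ hM]
      have : M * (t / (1 - t) * (-N / M) - Real.log M) = -(t / (1 - t) * N) - M * Real.log M := by
        field_simp
      rw [this, hC]
      linarith
    have h4 := mul_le_mul_of_nonneg_left hlog (by positivity : (0 : ℝ) ≤ k + 1)
    linarith

open ProbabilityTheory in
/-- Lower-tail concentration of the supremum of a Rademacher process. -/
theorem measureReal_radSup_le [Nonempty ι] (hg : ∀ j x, |g j x| ≤ 1)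
    (hgm : ∀ j, Measurable (g j))
    (hm : ∀ k, Measurable (radSup g : (Fin k → X × ℤˣ) → ℝ)) {s : ℝ} (hs0 : 0 ≤ s) (hs1 : s ≤ 1)
    (hs : ∀ j, ∫ x, g j x ^ 2 ∂μ ≤ s) (h0g : ∃ j, ∀ x, g j x = 0) (k : ℕ)
    {E : ℝ} (hE : E = ∫ ω, radSup g ω ∂(Measure.pi fun _ : Fin (k + 1) => μ.prod rademacher))
    {t : ℝ} (ht : 0 < t) :
    (Measure.pi fun _ : Fin (k + 1) => μ.prod rademacher).real
      {ω | radSup g ω < E - √(2 * (2 * E + (k + 1) * s) * t)} ≤ Real.exp (-t) := by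
  set P := Measure.pi fun _ : Fin (k + 1) => μ.prod rademacher with hP
  have hE0 : 0 ≤ E := hE ▸ integral_nonneg fun ω => radSup_nonneg hg h0g ω
  set v := 2 * E + (k + 1) * s with hv
  rcases le_or_gt E (√(2 * v * t)) with hle | hlt
  -- The threshold is nonpositive here, while the supremum is nonnegative because the family
  -- contains zero.
  · have : {ω : Fin (k + 1) → X × ℤˣ | radSup g ω < E - √(2 * v * t)} = ∅ := by
      ext ω
      rw [Set.mem_ofPred_eq, Set.mem_empty_iff_false, iff_false, not_lt]
      linarith [radSup_nonneg hg h0g ω]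
    rw [this, measureReal_empty]
    exact (Real.exp_pos _).le
  · have hE1 : 0 < E := (Real.sqrt_nonneg _).trans_lt hlt
    have hv0 : 0 < v := by positivity
    -- The minimizer of `l² v/2 - l √(2vt)`, with minimum `-t`. A positive threshold gives `l v ≤
    -- E`, and then `l ≤ 1/2` follows from `2E ≤ v`.
    set l := √(2 * v * t) / v with hl
    have hsq : √(2 * v * t) = l * v := by rw [hl]; field_simp
    have hsq2 : l ^ 2 * v = 2 * t := by
      rw [hl, div_pow, Real.sq_sqrt (by positivity)]; field_simp
    have hl0 : 0 < l := by positivity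
    have hlv : l * v ≤ E := hsq ▸ hlt.le
    have hl1 : l ≤ 1 / 2 := by
      have : 2 * E ≤ v := by rw [hv]; linarith [(by positivity : (0 : ℝ) ≤ (k + 1) * s)]
      rw [hl, div_le_iff₀ hv0]; linarith
    have hcgf := cgf_neg_radSup_le (μ := μ) hg hgm hm hs0 hs1 hs h0g k hl0 hl1
    rw [← hP, ← hE] at hcgf
    have hnum := neg_mul_exp_add_le hE0 hl0.le hl1 hlv
    rw [← hv] at hnum
    have hiexp : Integrable (fun ω => Real.exp (l * -radSup g ω)) P :=
      integrable_exp_mul_of_mem_Icc (hm (k + 1)).neg.aemeasurable (ae_of_all _ fun ω =>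
        ⟨neg_le_neg (radSup_le hg ω), neg_nonpos.2 (radSup_nonneg hg h0g ω)⟩)
    have hch := measure_ge_le_exp_cgf (-(E - √(2 * v * t))) hl0.le hiexp
    refine (measureReal_mono (s₂ := {ω | -(E - √(2 * v * t)) ≤ -radSup g ω})
      fun ω hω => ?_).trans (hch.trans (Real.exp_le_exp.2 ?_))
    · rw [Set.mem_ofPred_eq] at hω ⊢
      linarith
    · rw [hsq]
      nlinarith

end RadSup

/-! ### Deduction of the two inequalities. -/

/-- Let `T` be the root on the left. Substituting the bound on `R` into `T²` gives a quadratic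
inequality in `T`; completing the square adds `4c²` to `c²/2`, hence `9/2`, and `2c + c/8` gives
`17/8`. -/
theorem sqrt_add_le_sqrt_add {c w r R : ℝ} (hR : 0 ≤ R) (hc : 0 ≤ c) (hw : 0 ≤ w)
    (h : R ≤ r + √(4 * c * R + w) + c / 8) :
    √(4 * c * R + w) + c / 8 ≤ √(9 / 2 * c ^ 2 + 4 * c * r + w) + 17 / 8 * c := by
  have hT := Real.sq_sqrt (by positivity : 0 ≤ 4 * c * R + w)
  set T := √(4 * c * R + w)
  have := Real.le_sqrt_of_sq_le (show (T - 2 * c) ^ 2 ≤ 9 / 2 * c ^ 2 + 4 * c * r + w by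
    nlinarith [mul_le_mul_of_nonneg_left h hc])
  linarith

section Mcera

variable {X : Type*}

theorem mcera_eq_radSup (F : Set (X → ℝ)) {z : ℝ} (hz : 0 < z) {k : ℕ} (S : Fin k → X)
    (σ : Fin 1 → Fin k → ℤˣ) :
    mcera F S σ = z / k * radSup (fun (f : F) x => (f : X → ℝ) x / z) (fun i => (S i, σ 0 i)) := by
  simp only [mcera, radSup, Finset.univ_unique, Finset.sum_singleton, Fin.default_eq_zero,
    Nat.cast_one, div_one, one_mul]
  rw [Real.mul_iSup_of_nonneg (by positivity)]
  refine iSup_congr fun f => ?_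
  rw [Finset.mul_sum, Finset.mul_sum]
  refine Finset.sum_congr rfl fun i _ => ?_
  field_simp

variable [MeasurableSpace X]

theorem measurable_mcera_prod {F : Set (X → ℝ)} {k : ℕ}
    (hmeas : ∀ σ : Fin 1 → Fin k → ℤˣ, Measurable fun S : Fin k → X => mcera F S σ) :
    Measurable fun p : (Fin k → X) × (Fin 1 → Fin k → ℤˣ) => mcera F p.1 p.2 :=
  measurable_from_prod_countable_left hmeas

theorem measurable_radSup {F : Set (X → ℝ)} {z : ℝ} (hz : 0 < z) {k : ℕ}
    (hmeas : ∀ σ : Fin 1 → Fin k → ℤˣ, Measurable fun S : Fin k → X => mcera F S σ) :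
    Measurable (radSup (fun (f : F) x => (f : X → ℝ) x / z) : (Fin k → X × ℤˣ) → ℝ) := by
  rcases Nat.eq_zero_or_pos k with rfl | hk
  · exact Subsingleton.measurable
  · have h : (radSup (fun (f : F) x => (f : X → ℝ) x / z) : (Fin k → X × ℤˣ) → ℝ)
        = fun ω => k / z * mcera F (fun i => (ω i).1) (fun (_ : Fin 1) i => (ω i).2) := by
      ext ω
      have hk' : (k : ℝ) ≠ 0 := by positivity
      rw [mcera_eq_radSup F hz]
      field_simp
    rw [h]
    refine ((measurable_mcera_prod hmeas).comp
      (f := fun ω : Fin k → X × ℤˣ => ((fun i => (ω i).1), fun _ i => (ω i).2)) ?_).const_mul _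
    fun_prop

/-- Tensorization treats each point and its sign as one coordinate, so the sample and the sign
matrix are regrouped into i.i.d. pairs. -/
theorem measurePreserving_sample_sign (μ : Measure X) [IsProbabilityMeasure μ] (m : ℕ) :
    MeasurePreserving (fun ω : Fin m → X × ℤˣ =>
        ((fun i => (ω i).1, fun _ i => (ω i).2) : (Fin m → X) × (Fin 1 → Fin m → ℤˣ)))
      (Measure.pi fun _ => μ.prod rademacher) ((sampleLaw μ m).prod (signLaw 1 m)) := by
  have h1 := measurePreserving_arrowProdEquivProdArrow X ℤˣ (Fin m) (fun _ => μ)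
    (fun _ => rademacher)
  have h2 := (measurePreserving_funUnique
    (Measure.pi fun _ : Fin m => rademacher) (Fin 1)).symm
  exact ((MeasurePreserving.id (Measure.pi fun _ : Fin m => μ)).prod h2).comp h1

instance (μ : Measure X) [IsProbabilityMeasure μ] (m : ℕ) :
    IsProbabilityMeasure (sampleLaw μ m) := by
  unfold sampleLaw; infer_instance

instance (n m : ℕ) : IsProbabilityMeasure (signLaw n m) := by
  unfold signLaw; infer_instance

end Mcera

theorem mainTheorem4 {X : Type*} [MeasurableSpace X] (μ : Measure X) [IsProbabilityMeasure μ]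
    (F : Set (X → ℝ)) (a b z : ℝ) (hb : 0 < b) (ha : a ≤ 0) (hz : z = max |a| |b|)
    (hF : ∀ f ∈ F, ∀ x, f x ∈ Set.Icc a b) (h0 : (fun _ => 0) ∈ F)
    (hFmeas : ∀ f ∈ F, Measurable f)
    (hmeas : ∀ (k : ℕ) (σ : Fin 1 → Fin k → ℤˣ), Measurable fun S : Fin k → X => mcera F S σ)
    (m : ℕ) (hm : 0 < m) (δ : ℝ) (hδ0 : 0 < δ) (hδ1 : δ < 1) :
    1 - δ ≤ ((sampleLaw μ m).prod (signLaw 1 m)).real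
      {p : (Fin m → X) × (Fin 1 → Fin m → ℤˣ) |
        rademacherComplexity μ F m ≤
          mcera F p.1 p.2
            + √(2 * (2 * z * rademacherComplexity μ F m + wimpyVariance μ F)
                * Real.log (1 / δ) / m)
            + z * Real.log (1 / δ) / (8 * m) ∧
        mcera F p.1 p.2
            + √(2 * (2 * z * rademacherComplexity μ F m + wimpyVariance μ F)
                * Real.log (1 / δ) / m)
            + z * Real.log (1 / δ) / (8 * m) ≤
          mcera F p.1 p.2
            + √(9 / 8 * (2 * z * Real.log (1 / δ) / m) ^ 2
                + 2 * (2 * z * mcera F p.1 p.2 + wimpyVariance μ F) * Real.log (1 / δ) / m)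
            + 17 * z * Real.log (1 / δ) / (8 * m)} := by
  obtain ⟨k, rfl⟩ : ∃ k, m = k + 1 := ⟨m - 1, by omega⟩
  have hz0 : 0 < z := hz ▸ (abs_pos.2 hb.ne').trans_le (le_max_right _ _)
  have hfz : ∀ f ∈ F, ∀ x, |f x| ≤ z := fun f hf x =>
    hz ▸ abs_le_max_abs_abs (hF f hf x).1 (hF f hf x).2
  have : Nonempty F := ⟨⟨_, h0⟩⟩
  set g : F → X → ℝ := fun f x => (f : X → ℝ) x / z with hgdef
  have hg : ∀ j x, |g j x| ≤ 1 := fun j x => by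
    rw [hgdef, abs_div, abs_of_pos hz0, div_le_one hz0]; exact hfz _ j.2 x
  have hgm : ∀ j, Measurable (g j) := fun j => (hFmeas _ j.2).div_const z
  have h0g : ∃ j, ∀ x, g j x = 0 := ⟨⟨_, h0⟩, fun x => by simp [hgdef]⟩
  have hm' : ∀ k, Measurable (radSup g : (Fin k → X × ℤˣ) → ℝ) := fun k =>
    measurable_radSup hz0 (hmeas k)
  have hsq : ∀ f : F, ∫ x, (f : X → ℝ) x ^ 2 ∂μ ≤ z ^ 2 := fun f =>
    (integral_mem_Icc (c := 0) ((hFmeas _ f.2).pow_const 2) fun x =>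
      ⟨sq_nonneg _, sq_le_sq.2 ((hfz _ f.2 x).trans (le_abs_self z))⟩).2
  have hw1 : wimpyVariance μ F ≤ z ^ 2 := ciSup_le hsq
  have hwf : ∀ f : F, ∫ x, (f : X → ℝ) x ^ 2 ∂μ ≤ wimpyVariance μ F := fun f =>
    le_ciSup (f := fun f : F => ∫ x, (f : X → ℝ) x ^ 2 ∂μ)
      ⟨z ^ 2, by rintro _ ⟨f, rfl⟩; exact hsq f⟩ f
  have hw0 : 0 ≤ wimpyVariance μ F := by simpa using hwf ⟨_, h0⟩
  have hs : ∀ j, ∫ x, g j x ^ 2 ∂μ ≤ wimpyVariance μ F / z ^ 2 := fun j => by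
    simp only [hgdef, div_pow, integral_div]
    exact div_le_div_of_nonneg_right (hwf j) (by positivity)
  have hmp := measurePreserving_sample_sign μ (k + 1)
  have hmm := measurable_mcera_prod (hmeas (k + 1))
  set P := Measure.pi fun _ : Fin (k + 1) => μ.prod rademacher
  set E := ∫ ω, radSup g ω ∂P with hE
  have hE0 : 0 ≤ E := integral_nonneg fun ω => radSup_nonneg hg h0g ω
  have hkp : (0 : ℝ) < ((k + 1 : ℕ) : ℝ) := by positivity
  have hR : rademacherComplexity μ F (k + 1) = z / (k + 1 : ℕ) * E := by
    have hi : Integrable (fun p : (Fin (k + 1) → X) × (Fin 1 → Fin (k + 1) → ℤˣ) =>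
        mcera F p.1 p.2) ((sampleLaw μ (k + 1)).prod (signLaw 1 (k + 1))) := by
      refine integrable_of_mem_Icc (c := 0) (C := z / (k + 1 : ℕ) * (k + 1 : ℕ)) hmm fun p => ?_
      rw [mcera_eq_radSup F hz0]
      exact ⟨mul_nonneg (by positivity) (radSup_nonneg hg h0g _),
        mul_le_mul_of_nonneg_left (radSup_le hg _) (by positivity)⟩
    have h2 := integral_prod _ hi
    rw [← hmp.map_eq, integral_map hmp.measurable.aemeasurable hmm.aestronglyMeasurable] at h2
    simp only [mcera_eq_radSup F hz0 (fun i => (_ : Fin (k + 1) → X × ℤˣ) i |>.1),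
      integral_const_mul] at h2
    exact h2.symm
  set R := rademacherComplexity μ F (k + 1)
  set w := wimpyVariance μ F
  set L := Real.log (1 / δ) with hLdef
  have hL : 0 < L := Real.log_pos (by rw [lt_div_iff₀ hδ0]; linarith)
  have hexp : Real.exp (-L) = δ := by
    rw [hLdef, one_div, Real.log_inv, neg_neg, Real.exp_log hδ0]
  have hR0 : 0 ≤ R := by rw [hR]; positivity
  have htail := measureReal_radSup_le (μ := μ) hg hgm hm' (by positivity)
    (div_le_one_of_le₀ hw1 (by positivity)) hs h0g k hE hL
  rw [hexp] at htail
  set good : Set ((Fin (k + 1) → X) × (Fin 1 → Fin (k + 1) → ℤˣ)) :=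
    {p | R ≤ mcera F p.1 p.2 + √(2 * (2 * z * R + w) * L / (k + 1 : ℕ))
      + z * L / (8 * (k + 1 : ℕ))} with hgood
  have hgoodm : MeasurableSet good :=
    measurableSet_le measurable_const ((hmm.add_const _).add_const _)
  have hbad : ((sampleLaw μ (k + 1)).prod (signLaw 1 (k + 1))).real goodᶜ ≤ δ := by
    rw [← hmp.measureReal_preimage hgoodm.compl.nullMeasurableSet]
    refine (measureReal_mono fun ω hω => ?_).trans htail
    rw [hgood, Set.mem_preimage, Set.mem_compl_iff, Set.mem_ofPred_eq, not_le,
      mcera_eq_radSup F hz0] at hω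
    rw [Set.mem_ofPred_eq]
    have hω' : z / (k + 1 : ℕ) * radSup g ω + √(2 * (2 * z * R + w) * L / (k + 1 : ℕ))
      + z * L / (8 * (k + 1 : ℕ)) < R := hω
    have e : √(2 * (2 * z * R + w) * L / (k + 1 : ℕ))
        = z / (k + 1 : ℕ) * √(2 * (2 * E + (k + 1) * (w / z ^ 2)) * L) := by
      rw [← Real.sqrt_sq (by positivity : 0 ≤ z / ((k + 1 : ℕ) : ℝ)),
        ← Real.sqrt_mul (by positivity), hR]
      congr 1
      push_cast
      field_simp
    -- The tail bound already holds without the term `z L / (8m)`, which is pure slack in the first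
    -- inequality.
    have hpos : 0 ≤ z * L / (8 * ((k + 1 : ℕ) : ℝ)) := by positivity
    rw [e, hR] at hω'
    have := lt_of_mul_lt_mul_left (a := z / ((k + 1 : ℕ) : ℝ))
      (b := radSup g ω + √(2 * (2 * E + (k + 1) * (w / z ^ 2)) * L)) (c := E)
      (by linarith) (by positivity)
    linarith
  rw [measureReal_compl hgoodm, probReal_univ] at hbad
  refine le_trans (by linarith) (measureReal_mono (s₁ := good) fun p hp => ⟨hp, ?_⟩)
  rw [hgood, Set.mem_ofPred_eq] at hp
  have hc : 0 ≤ z * L / ((k + 1 : ℕ) : ℝ) := by positivity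
  have e1 : 2 * (2 * z * R + w) * L / ((k + 1 : ℕ) : ℝ)
      = 4 * (z * L / ((k + 1 : ℕ) : ℝ)) * R + 2 * w * L / ((k + 1 : ℕ) : ℝ) := by ring
  have e2 : 9 / 8 * (2 * z * L / ((k + 1 : ℕ) : ℝ)) ^ 2
      + 2 * (2 * z * mcera F p.1 p.2 + w) * L / ((k + 1 : ℕ) : ℝ)
      = 9 / 2 * (z * L / ((k + 1 : ℕ) : ℝ)) ^ 2
        + 4 * (z * L / ((k + 1 : ℕ) : ℝ)) * mcera F p.1 p.2
        + 2 * w * L / ((k + 1 : ℕ) : ℝ) := by ring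
  have e3 : z * L / (8 * ((k + 1 : ℕ) : ℝ)) = z * L / ((k + 1 : ℕ) : ℝ) / 8 := by ring
  have e4 : 17 * z * L / (8 * ((k + 1 : ℕ) : ℝ)) = 17 / 8 * (z * L / ((k + 1 : ℕ) : ℝ)) := by ring
  rw [e1, e3] at hp
  rw [e1, e2, e3, e4]
  have := sqrt_add_le_sqrt_add hR0 hc (by positivity) hp
  linarith
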